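/- Let $R$ be one of the two rings $\mathbb{Z}_{25}=\mathbb{Z}/25\mathbb{Z}$ and $\mathbb{S}_5=\mathbb{F}_5[X]/(X^2)$. The projective Hjelmslev plane $\mathrm{PHG}(2,R)$ is the incidence structure whose points are the free rank $1$ submodules of $R^3$, whose lines are the free rank $2$ submodules of $R^3$, and whose incidence relation is inclusion. A multiset of points is a function $\mathfrak{K}$ from the set of points to the nonnegative integers, and $\mathfrak{K}(S)=\sum_{x\in S}\mathfrak{K}(x)$ for a set $S$ of points. It is projective if $\mathfrak{K}(x)\in\{0,1\}$ for every point $x$. It is a $(k,n)$-arc if $\mathfrak{K}(\mathcal{P})=k$, where $\mathcal{P}$ is the set of all points, and $\mathfrak{K}(L)\le n$ for every line $L$, a line being identified with the set of points incident with it. Let $\mathrm{m}_n(R)$ denote the largest $k$ for which a projective $(k,n)$-arc in $\mathrm{PHG}(2,R)$ exists. Then $\mathrm{m}_3(\mathbb{Z}_{25})\le 43$ and $\mathrm{m}_3(\mathbb{S}_5)\le 43$. -/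

import Mathlib

/-- (Used below for sums over points.) The submodules of `R³` form a finite set if `R` is finite. -/
theorem PHG.finite_submodule (R : Type*) [CommRing R] [Finite R] :
    Finite (Submodule R (Fin 3 → R)) :=
  Finite.of_injective (fun U : Submodule R (Fin 3 → R) => (U : Set (Fin 3 → R)))
    SetLike.coe_injective

/-- The points of the projective Hjelmslev plane `PHG(2, R)`: the free rank `1` submodules of `R³`.
For a commutative ring, left and right submodules are the same. -/
def PHG.Point (R : Type*) [CommRing R] : Type _ :=
  {U : Submodule R (Fin 3 → R) // Module.Free R U ∧ Module.finrank R U = 1}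

/-- The lines of `PHG(2, R)`: the free rank `2` submodules of `R³`. -/
def PHG.Line (R : Type*) [CommRing R] : Type _ :=
  {U : Submodule R (Fin 3 → R) // Module.Free R U ∧ Module.finrank R U = 2}

/-- The set of points incident with a line; incidence is inclusion of submodules. -/
def PHG.Line.points {R : Type*} [CommRing R] (L : PHG.Line R) : Set (PHG.Point R) :=
  {x | x.1 ≤ L.1}

instance PHG.finite_point (R : Type*) [CommRing R] [Finite R] : Finite (PHG.Point R) :=
  haveI := PHG.finite_submodule R
  Subtype.finite

noncomputable instance PHG.fintype_point (R : Type*) [CommRing R] [Finite R] :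
    Fintype (PHG.Point R) :=
  Fintype.ofFinite _

/-- The multiplicity `K(S) = ∑_{x ∈ S} K(x)` of a set `S` of points with respect to a
multiset of points `K`. -/
noncomputable def PHG.multiplicity {R : Type*} [CommRing R] [Finite R]
    (K : PHG.Point R → ℕ) (S : Set (PHG.Point R)) : ℕ :=
  open scoped Classical in ∑ x : PHG.Point R with x ∈ S, K x

/-- `K` is a `(k, n)`-arc: it has cardinality `k` and every line has multiplicity at most `n`. -/
def PHG.IsArc {R : Type*} [CommRing R] [Finite R] (K : PHG.Point R → ℕ) (k n : ℕ) : Prop :=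
  PHG.multiplicity K Set.univ = k ∧ ∀ L : PHG.Line R, PHG.multiplicity K L.points ≤ n

/-- A multiset of points is projective if all its multiplicities are `0` or `1`. -/
def PHG.IsProjective {R : Type*} [CommRing R] (K : PHG.Point R → ℕ) : Prop :=
  ∀ x, K x = 0 ∨ K x = 1

/-- `m_n(R)`: the largest `k` for which a projective `(k, n)`-arc in `PHG(2, R)` exists.
The supremum is a maximum, see `PHG.isGreatest_maxArc`. -/
noncomputable def PHG.maxArc (R : Type*) [CommRing R] [Finite R] (n : ℕ) : ℕ :=
  sSup {k : ℕ | ∃ K : PHG.Point R → ℕ, PHG.IsProjective K ∧ PHG.IsArc K k n}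

theorem PHG.isGreatest_maxArc (R : Type*) [CommRing R] [Finite R] (n : ℕ) :
    IsGreatest {k : ℕ | ∃ K : PHG.Point R → ℕ, PHG.IsProjective K ∧ PHG.IsArc K k n}
      (PHG.maxArc R n) := by
  have hne : {k : ℕ | ∃ K : PHG.Point R → ℕ, PHG.IsProjective K ∧ PHG.IsArc K k n}.Nonempty :=
    ⟨0, fun _ => 0, fun _ => Or.inl rfl, by simp [PHG.IsArc, PHG.multiplicity]⟩
  have hbdd : BddAbove {k : ℕ | ∃ K : PHG.Point R → ℕ, PHG.IsProjective K ∧ PHG.IsArc K k n} := by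
    refine ⟨Fintype.card (PHG.Point R), ?_⟩
    rintro k ⟨K, hK, rfl, -⟩
    have h : ∑ x : PHG.Point R, K x ≤ ∑ _x : PHG.Point R, 1 :=
      Finset.sum_le_sum fun x _ => by rcases hK x with h | h <;> omega
    simpa [PHG.multiplicity] using h
  exact ⟨Nat.sSup_mem hne hbdd, fun k hk => le_csSup hbdd hk⟩

/-- The ring `𝕊₅ = 𝔽₅[X]/(X²)`. -/
abbrev PHG.S5 : Type :=
  Polynomial (ZMod 5) ⧸ Ideal.span {(Polynomial.X ^ 2 : Polynomial (ZMod 5))}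

instance PHG.finite_S5 : Finite PHG.S5 :=
  haveI : Fact (Nat.Prime 5) := ⟨by norm_num⟩
  haveI : Module.Finite (ZMod 5) PHG.S5 :=
    (Polynomial.monic_X_pow (R := ZMod 5) 2).finite_quotient
  Module.finite_of_finite (ZMod 5)

/-! Reduce modulo the radical: points and lines fall into neighbour classes, indexed by the points
`c` and the lines `d` of `PG(2, 5)`. The points of a class `c` form an affine plane of order 5,
whose lines, the segments, have the six lines `d` through `c` as directions. Dually, the 25 lines of
a class `d` are the points of an affine plane whose lines are the segments of direction `d`,
parallel when they lie in the same point class (`PG25.isFiveNet`). The arc points in classes on `d`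
thus give a family of lines of an affine plane, and the arc condition says that no point of that
plane is covered more than three times.

Two bounds on such families carry the proof: at most 10 lines if they are distinct and each parallel
class has at most 2 of them (`IsFiveNet.card_le_ten`), and at most `u + 8` if the largest parallel
class has size `u`, where `u` is 3 or 4 (`IsFiveNet.card_le_add_eight`).

Suppose that an arc has 44 points, `w c` of them in class `c`. Averaging over the six directions
through `c` forces `w c ≤ 2`. Call a direction special if one of its segments carries two arc
points. Each class of weight 2 has exactly one special direction, distinct classes have distinct
ones, and special directions are light (total weight at most 7 instead of 10). Counting incidences
with special directions gives the contradiction (`ArcNumbers.not_arcNumbers`). -/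

open Finset
open scoped Matrix

/-! ### Families of lines in an affine plane of order 5 covering no point more than three times -/

/-- Parallel classes, indexed by `D`, of an affine plane of order `5` with point set `B`. The lines
of the class `i` are the fibres of `φ i`. -/
structure IsFiveNet {I B : Type*} [Fintype B] (D : Finset I) (φ : I → B → ZMod 5) : Prop where
  card_line : ∀ i ∈ D, ∀ s, #{b | φ i b = s} = 5
  card_inter : ∀ i ∈ D, ∀ j ∈ D, i ≠ j → ∀ s t, #{b | φ i b = s ∧ φ j b = t} = 1

/-- The number of lines of the family `T` through the point `b`, where `x ∈ T` stands for the line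
`φ (cl x) = σ x`. -/
def coverNumber {X I B : Type*} (φ : I → B → ZMod 5) (cl : X → I) (σ : X → ZMod 5)
    (T : Finset X) (b : B) : ℕ :=
  #{x ∈ T | φ (cl x) b = σ x}

theorem sum_coverNumber_eq {X I B : Type*} (φ : I → B → ZMod 5) (cl : X → I) (σ : X → ZMod 5)
    (T : Finset X) (S : Finset B) :
    ∑ b ∈ S, coverNumber φ cl σ T b = ∑ x ∈ T, #{b ∈ S | φ (cl x) b = σ x} := by
  simp only [coverNumber, card_filter]
  exact sum_comm

theorem coverNumber_mono {X I B : Type*} (φ : I → B → ZMod 5) (cl : X → I) (σ : X → ZMod 5)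
    {T T' : Finset X} (hT : T' ⊆ T) (b : B) : coverNumber φ cl σ T' b ≤ coverNumber φ cl σ T b :=
  card_le_card (filter_subset_filter _ hT)

theorem dvd_card_filter_card_fiber_eq {X I : Type*} [DecidableEq I] (T : Finset X) (cl : X → I)
    (m : ℕ) : m ∣ #{x ∈ T | #{y ∈ T | cl y = cl x} = m} := by
  rw [card_eq_sum_card_image cl]
  refine dvd_sum fun i hi => ?_
  obtain ⟨x, hx, rfl⟩ := mem_image.1 hi
  have hx' := (mem_filter.1 hx).2
  refine dvd_of_eq ?_
  rw [filter_filter]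
  conv_lhs => rw [← hx']
  congr 1
  ext y
  simp only [mem_filter]
  constructor
  · rintro ⟨hy, hc⟩
    exact ⟨hy, by rw [hc]; exact hx', hc⟩
  · rintro ⟨hy, -, hc⟩
    exact ⟨hy, hc⟩

theorem card_eq_of_values {B : Type*} (S : Finset B) (f : B → ℕ)
    (hf : ∀ b ∈ S, f b = 0 ∨ f b = 2 ∨ f b = 3) :
    #S = #{b ∈ S | f b = 0} + #{b ∈ S | f b = 2} + #{b ∈ S | f b = 3} := by
  rw [card_filter, card_filter, card_filter, card_eq_sum_ones, ← sum_add_distrib,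
    ← sum_add_distrib]
  refine sum_congr rfl fun b hb => ?_
  rcases hf b hb with h | h | h <;> simp [h]

theorem sum_eq_of_values {B : Type*} (S : Finset B) (f : B → ℕ)
    (hf : ∀ b ∈ S, f b = 0 ∨ f b = 2 ∨ f b = 3) :
    ∑ b ∈ S, f b = 2 * #{b ∈ S | f b = 2} + 3 * #{b ∈ S | f b = 3} := by
  rw [card_filter, card_filter, mul_sum, mul_sum, ← sum_add_distrib]
  refine sum_congr rfl fun b hb => ?_
  rcases hf b hb with h | h | h <;> simp [h]

namespace IsFiveNet

variable {X I B : Type*} [Fintype B]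
  {D : Finset I} {φ : I → B → ZMod 5} {cl : X → I} {σ : X → ZMod 5} {T : Finset X}

theorem card_points (h : IsFiveNet D φ) {i : I} (hi : i ∈ D) : Fintype.card B = 25 := by
  have := card_eq_sum_card_fiberwise (f := φ i) (s := (univ : Finset B))
    (t := (univ : Finset (ZMod 5))) (fun _ _ => by simp)
  rw [Finset.card_univ] at this
  rw [this, sum_congr rfl (fun s _ => h.card_line i hi s)]
  simp

theorem eq_of_eq (h : IsFiveNet D φ) {i j : I} (hi : i ∈ D) (hj : j ∈ D) (hij : i ≠ j) {p q : B}
    (h1 : φ i p = φ i q) (h2 : φ j p = φ j q) : p = q :=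
  card_le_one.1 (h.card_inter i hi j hj hij (φ i q) (φ j q)).le p (by simp [h1, h2]) q (by simp)

theorem sum_coverNumber_univ (h : IsFiveNet D φ) (hT : ∀ x ∈ T, cl x ∈ D) :
    ∑ b, coverNumber φ cl σ T b = 5 * #T := by
  rw [sum_coverNumber_eq, sum_congr rfl (fun x hx => h.card_line _ (hT x hx) (σ x))]
  simp [mul_comm]

variable [DecidableEq I]

theorem sum_coverNumber (h : IsFiveNet D φ) (hT : ∀ x ∈ T, cl x ∈ D) {i : I} (hi : i ∈ D)
    (s : ZMod 5) :
    ∑ b with φ i b = s, coverNumber φ cl σ T b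
      = 5 * #{x ∈ T | cl x = i ∧ σ x = s} + #{x ∈ T | cl x ≠ i} := by
  rw [sum_coverNumber_eq, card_filter, card_filter, mul_sum, ← sum_add_distrib]
  refine sum_congr rfl fun x hx => ?_
  rw [filter_filter]
  by_cases hc : cl x = i
  · subst hc
    by_cases hs : σ x = s
    · subst hs
      simp [h.card_line _ hi]
    · have : ∀ b, ¬ (φ (cl x) b = s ∧ φ (cl x) b = σ x) := fun b hb => hs (hb.2.symm.trans hb.1)
      simp [this, hs]
  · simp [hc, h.card_inter i hi _ (hT x hx) (Ne.symm hc)]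

/-- Count incidences along one line: a copy of it in the family contributes 5, other parallels
nothing, every transversal 1, and the five points carry at most 3 each. -/
theorem five_mul_add_le (h : IsFiveNet D φ) (hT : ∀ x ∈ T, cl x ∈ D)
    (hm : ∀ b, coverNumber φ cl σ T b ≤ 3) {i : I} (hi : i ∈ D) (s : ZMod 5) :
    5 * #{x ∈ T | cl x = i ∧ σ x = s} + #{x ∈ T | cl x ≠ i} ≤ 15 := by
  rw [← h.sum_coverNumber hT hi s]
  calc _ ≤ ∑ b with φ i b = s, 3 := sum_le_sum fun b _ => hm b
    _ = 15 := by simp [h.card_line i hi]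

theorem add_le_three (h : IsFiveNet D φ) (hm : ∀ b, coverNumber φ cl σ T b ≤ 3) {i j : I}
    (hi : i ∈ D) (hj : j ∈ D) (hij : i ≠ j) (s t : ZMod 5) :
    #{x ∈ T | cl x = i ∧ σ x = s} + #{x ∈ T | cl x = j ∧ σ x = t} ≤ 3 := by
  classical
  obtain ⟨b, hb⟩ := card_pos.1 (by rw [h.card_inter i hi j hj hij s t]; norm_num :
    0 < #{b | φ i b = s ∧ φ j b = t})
  simp only [mem_filter, mem_univ, true_and] at hb
  rw [← card_union_of_disjoint]
  · refine (card_le_card ?_).trans (hm b)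
    intro x hx
    simp only [mem_union, mem_filter] at hx ⊢
    rcases hx with ⟨hx, rfl, rfl⟩ | ⟨hx, rfl, rfl⟩
    · exact ⟨hx, hb.1⟩
    · exact ⟨hx, hb.2⟩
  · rw [disjoint_left]
    intro x hx hx'
    simp only [mem_filter] at hx hx'
    exact hij (hx.2.1.symm.trans hx'.2.1)

theorem card_eq_one_of_mem (hinj : ∀ x ∈ T, ∀ y ∈ T, cl x = cl y → σ x = σ y → x = y)
    {x : X} (hx : x ∈ T) : #{y ∈ T | cl y = cl x ∧ σ y = σ x} = 1 := by
  rw [card_eq_one]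
  refine ⟨x, ?_⟩
  ext y
  simp only [mem_filter, mem_singleton]
  exact ⟨fun hy => hinj y hy.1 x hx hy.2.1 hy.2.2, by rintro rfl; exact ⟨hx, rfl, rfl⟩⟩

theorem card_le_card_fiber_add_ten (h : IsFiveNet D φ) (hT : ∀ x ∈ T, cl x ∈ D)
    (hm : ∀ b, coverNumber φ cl σ T b ≤ 3)
    (hinj : ∀ x ∈ T, ∀ y ∈ T, cl x = cl y → σ x = σ y → x = y) {x : X} (hx : x ∈ T) :
    #T ≤ #{y ∈ T | cl y = cl x} + 10 := by
  have h1 := h.five_mul_add_le hT hm (hT x hx) (σ x)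
  rw [card_eq_one_of_mem hinj hx] at h1
  have h2 := card_filter_add_card_filter_not (s := T) (fun y => cl y = cl x)
  simp only [ne_eq] at h1
  omega

/-- On a line of the family, the missing amount `3 - m` adds up to `a - c`, with `a` the size of the
parallel class and `10 + c` the size of the family. -/
theorem sum_coverNumber_add (h : IsFiveNet D φ) (hT : ∀ x ∈ T, cl x ∈ D)
    (hm : ∀ b, coverNumber φ cl σ T b ≤ 3)
    (hinj : ∀ x ∈ T, ∀ y ∈ T, cl x = cl y → σ x = σ y → x = y) {c : ℕ} (hc : #T = 10 + c)
    {x : X} (hx : x ∈ T) :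
    ∑ b with φ (cl x) b = σ x, (3 - coverNumber φ cl σ T b) + c = #{y ∈ T | cl y = cl x} := by
  have h1 := h.sum_coverNumber hT (hT x hx) (σ x) (σ := σ)
  rw [card_eq_one_of_mem hinj hx] at h1
  have h2 := card_filter_add_card_filter_not (s := T) (fun y => cl y = cl x)
  have h3 : ∑ b with φ (cl x) b = σ x, (3 - coverNumber φ cl σ T b)
      + ∑ b with φ (cl x) b = σ x, coverNumber φ cl σ T b = 15 := by
    rw [← sum_add_distrib, sum_congr rfl (fun b _ => Nat.sub_add_cancel (hm b))]
    simp [h.card_line _ (hT x hx)]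
  simp only [ne_eq] at h1
  omega

/-- Along a line of the family the total deficit `a - c` is at most 1, so a covered point misses at
most one of its three lines. -/
theorem coverNumber_eq_zero_or (h : IsFiveNet D φ) (hT : ∀ x ∈ T, cl x ∈ D)
    (hm : ∀ b, coverNumber φ cl σ T b ≤ 3)
    (hinj : ∀ x ∈ T, ∀ y ∈ T, cl x = cl y → σ x = σ y → x = y) {c : ℕ} (hc : #T = 10 + c)
    (ha : ∀ x ∈ T, #{y ∈ T | cl y = cl x} ≤ c + 1) (b : B) :
    coverNumber φ cl σ T b = 0 ∨ coverNumber φ cl σ T b = 2 ∨ coverNumber φ cl σ T b = 3 := by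
  by_cases h0 : coverNumber φ cl σ T b = 0
  · exact Or.inl h0
  obtain ⟨x, hx⟩ := card_pos.1 (Nat.pos_of_ne_zero h0)
  rw [mem_filter] at hx
  have h1 := h.sum_coverNumber_add hT hm hinj hc hx.1
  have h2 := single_le_sum (f := fun b => 3 - coverNumber φ cl σ T b) (fun _ _ => Nat.zero_le _)
    (by simpa using hx.2 : b ∈ ({b | φ (cl x) b = σ x} : Finset B))
  have h3 := ha x hx.1
  have h4 := hm b
  omega

/-- Double counting: a line of the family contains `a - c` doubly covered points, and each of these
lies on two lines of the family. -/
theorem two_mul_card_two (h : IsFiveNet D φ) (hT : ∀ x ∈ T, cl x ∈ D)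
    (hm : ∀ b, coverNumber φ cl σ T b ≤ 3)
    (hinj : ∀ x ∈ T, ∀ y ∈ T, cl x = cl y → σ x = σ y → x = y) {c : ℕ} (hc : #T = 10 + c)
    (ha : ∀ x ∈ T, #{y ∈ T | cl y = cl x} ≤ c + 1) :
    2 * #{b | coverNumber φ cl σ T b = 2} + c * #T = ∑ x ∈ T, #{y ∈ T | cl y = cl x} := by
  have h1 : 2 * #{b | coverNumber φ cl σ T b = 2}
      = ∑ x ∈ T, #{b | coverNumber φ cl σ T b = 2 ∧ φ (cl x) b = σ x} := by
    have := sum_coverNumber_eq φ cl σ T {b | coverNumber φ cl σ T b = 2}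
    simp only [filter_filter] at this
    rw [← this, sum_congr rfl (fun b hb => (mem_filter.1 hb).2)]
    simp [mul_comm]
  rw [h1, mul_comm c, ← smul_eq_mul, ← sum_const, ← sum_add_distrib]
  refine sum_congr rfl fun x hx => ?_
  rw [← h.sum_coverNumber_add hT hm hinj hc hx]
  congr 1
  rw [← filter_filter, filter_comm, card_filter]
  refine sum_congr rfl fun b hb => ?_
  have : coverNumber φ cl σ T b ≠ 0 := by
    refine (card_pos.2 ⟨x, ?_⟩).ne'
    exact mem_filter.2 ⟨hx, (mem_filter.1 hb).2⟩
  rcases h.coverNumber_eq_zero_or hT hm hinj hc ha b with h0 | h0 | h0 <;> simp_all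

theorem two_le_card_two_of_notMem (h : IsFiveNet D φ) (hT : ∀ x ∈ T, cl x ∈ D)
    (hm : ∀ b, coverNumber φ cl σ T b ≤ 3)
    (hinj : ∀ x ∈ T, ∀ y ∈ T, cl x = cl y → σ x = σ y → x = y) {c : ℕ} (hc : #T = 10 + c)
    (ha : ∀ x ∈ T, #{y ∈ T | cl y = cl x} ≤ c + 1) {j : I} (hj : j ∈ D)
    (hjc : #{y ∈ T | cl y = j} = c) {s : ZMod 5} (hs : ∀ x ∈ T, cl x = j → σ x ≠ s) :
    2 ≤ #{b | φ j b = s ∧ coverNumber φ cl σ T b = 2} := by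
  have h1 := h.sum_coverNumber hT hj s (σ := σ)
  have h2 := card_filter_add_card_filter_not (s := T) (fun y => cl y = j)
  have h3 : #{x ∈ T | cl x = j ∧ σ x = s} = 0 := by
    rw [card_eq_zero, filter_eq_empty_iff]
    exact fun x hx hx' => hs x hx hx'.1 hx'.2
  have h4 := h.card_line j hj s
  have h5 := card_eq_of_values {b | φ j b = s} (coverNumber φ cl σ T)
    (fun b _ => h.coverNumber_eq_zero_or hT hm hinj hc ha b)
  have h6 := sum_eq_of_values {b | φ j b = s} (coverNumber φ cl σ T)
    (fun b _ => h.coverNumber_eq_zero_or hT hm hinj hc ha b)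
  simp only [filter_filter] at h5 h6
  simp only [ne_eq] at h1
  -- Five values from `0, 2, 3` with sum 10: either `2, 2, 2, 2, 2` or `0, 2, 2, 3, 3`.
  omega

/-- At least `5 - c` lines of the parallel class `j` are missing from the family, and each of them
has two doubly covered points. -/
theorem ten_le_card_two_add (h : IsFiveNet D φ) (hT : ∀ x ∈ T, cl x ∈ D)
    (hm : ∀ b, coverNumber φ cl σ T b ≤ 3)
    (hinj : ∀ x ∈ T, ∀ y ∈ T, cl x = cl y → σ x = σ y → x = y) {c : ℕ} (hc : #T = 10 + c)
    (ha : ∀ x ∈ T, #{y ∈ T | cl y = cl x} ≤ c + 1) {j : I} (hj : j ∈ D)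
    (hjc : #{y ∈ T | cl y = j} = c) :
    10 ≤ #{b | coverNumber φ cl σ T b = 2} + 2 * c := by
  have h1 : #{b | coverNumber φ cl σ T b = 2}
      = ∑ s, #{b | φ j b = s ∧ coverNumber φ cl σ T b = 2} := by
    rw [card_eq_sum_card_fiberwise (f := φ j) (t := univ) (fun _ _ => by simp)]
    simp only [filter_filter, and_comm]
  have h2 : ∑ s ∈ univ \ image σ {y ∈ T | cl y = j}, 2
      ≤ ∑ s, #{b | φ j b = s ∧ coverNumber φ cl σ T b = 2} := by
    refine le_trans (sum_le_sum fun s hs => ?_)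
      (sum_le_univ_sum_of_nonneg (s := univ \ image σ {y ∈ T | cl y = j}) fun _ => Nat.zero_le _)
    refine h.two_le_card_two_of_notMem hT hm hinj hc ha hj hjc fun x hx hxj hxs => ?_
    simp only [mem_sdiff, mem_univ, true_and, mem_image, mem_filter, not_exists, not_and] at hs
    exact hs x ⟨hx, hxj⟩ hxs
  have h3 : #(image σ {y ∈ T | cl y = j}) ≤ c := hjc ▸ card_image_le
  have h4 := card_sdiff_add_card_inter (univ : Finset (ZMod 5)) (image σ {y ∈ T | cl y = j})
  rw [univ_inter, card_univ, ZMod.card] at h4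
  rw [sum_const, smul_eq_mul] at h2
  omega

theorem card_le_ten (h : IsFiveNet D φ) (hT : ∀ x ∈ T, cl x ∈ D)
    (hm : ∀ b, coverNumber φ cl σ T b ≤ 3)
    (hinj : ∀ x ∈ T, ∀ y ∈ T, cl x = cl y → σ x = σ y → x = y)
    (ha : ∀ i ∈ D, #{y ∈ T | cl y = i} ≤ 2) : #T ≤ 10 := by
  by_contra! hlt
  obtain ⟨U, hUT, hU⟩ := exists_subset_card_eq (by omega : 11 ≤ #T)
  have hT' : ∀ x ∈ U, cl x ∈ D := fun x hx => hT x (hUT hx)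
  have hm' : ∀ b, coverNumber φ cl σ U b ≤ 3 := fun b => (coverNumber_mono _ _ _ hUT b).trans (hm b)
  have hinj' : ∀ x ∈ U, ∀ y ∈ U, cl x = cl y → σ x = σ y → x = y :=
    fun x hx y hy => hinj x (hUT hx) y (hUT hy)
  have ha' : ∀ x ∈ U, #{y ∈ U | cl y = cl x} ≤ 1 + 1 := fun x hx =>
    (card_le_card (filter_subset_filter _ hUT)).trans (ha _ (hT' x hx))
  by_cases hj : ∃ x ∈ U, #{y ∈ U | cl y = cl x} = 1
  · obtain ⟨x, hx, hx1⟩ := hj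
    have h1 := h.ten_le_card_two_add hT' hm' hinj' hU ha' (hT' x hx) hx1
    have h2 := h.two_mul_card_two hT' hm' hinj' hU ha'
    have h3 : ∑ x ∈ U, #{y ∈ U | cl y = cl x} ≤ ∑ x ∈ U, 2 := sum_le_sum ha'
    rw [sum_const, hU, smul_eq_mul] at h3
    -- At least 8 doubly covered points are needed, but `2 * n + 11 ≤ 22` leaves at most 5.
    omega
  · have h1 := dvd_card_filter_card_fiber_eq U cl 2
    rw [filter_true_of_mem, hU] at h1
    · omega
    · intro x hx
      have h2 := ha' x hx
      have h3 : #{y ∈ U | cl y = cl x} ≠ 1 := fun h3 => hj ⟨x, hx, h3⟩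
      have h4 : 0 < #{y ∈ U | cl y = cl x} := card_pos.2 ⟨x, mem_filter.2 ⟨hx, rfl⟩⟩
      omega

/-- A family with four parallel classes of three lines each has a quadruply covered point. -/
theorem false_of_card_eq_twelve (h : IsFiveNet D φ) (hT : ∀ x ∈ T, cl x ∈ D)
    (hm : ∀ b, coverNumber φ cl σ T b ≤ 3)
    (hinj : ∀ x ∈ T, ∀ y ∈ T, cl x = cl y → σ x = σ y → x = y) (hc : #T = 12)
    (ha : ∀ x ∈ T, #{y ∈ T | cl y = cl x} = 3) : False := by
  classical
  have ha' : ∀ x ∈ T, #{y ∈ T | cl y = cl x} ≤ 2 + 1 := fun x hx => (ha x hx).le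
  have hval := h.coverNumber_eq_zero_or hT hm hinj hc ha'
  obtain ⟨x₀, hx₀⟩ : T.Nonempty := card_pos.1 (by omega)
  -- The counts are forced: 6 points covered twice, 16 covered three times, hence 3 uncovered.
  have hZ : #{b | coverNumber φ cl σ T b = 0} = 3 := by
    have h1 := h.two_mul_card_two hT hm hinj hc ha'
    rw [sum_congr rfl ha, sum_const, hc, smul_eq_mul] at h1
    have h2 := card_eq_of_values univ (coverNumber φ cl σ T) (fun b _ => hval b)
    have h3 := sum_eq_of_values univ (coverNumber φ cl σ T) (fun b _ => hval b)
    rw [h.sum_coverNumber_univ hT, hc] at h3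
    rw [card_univ, h.card_points (hT x₀ hx₀)] at h2
    omega
  have hJ : #(T.image cl) = 4 := by
    have h1 := card_eq_sum_card_image cl T
    rw [sum_congr rfl (g := fun _ => 3), sum_const, hc, smul_eq_mul] at h1
    · omega
    · intro i hi
      obtain ⟨x, hx, rfl⟩ := mem_image.1 hi
      exact ha x hx
  -- The three uncovered points lie on the two missing lines of each parallel class, so two of them
  -- share such a line.
  have hpair : ∀ i ∈ T.image cl, ∃ P ∈ powersetCard 2 {b | coverNumber φ cl σ T b = 0},
      ∃ p ∈ P, ∃ q ∈ P, p ≠ q ∧ φ i p = φ i q := by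
    intro i hi
    obtain ⟨x, hx, rfl⟩ := mem_image.1 hi
    have himg : #(image σ {y ∈ T | cl y = cl x}) = 3 := by
      rw [← ha x hx]
      refine card_image_of_injOn fun y hy z hz hyz => ?_
      simp only [coe_filter, Set.mem_ofPred_eq] at hy hz
      exact hinj y hy.1 z hz.1 (hy.2.trans hz.2.symm) hyz
    have hcompl : #(univ \ image σ {y ∈ T | cl y = cl x}) = 2 := by
      have h4 := card_sdiff_add_card_inter (univ : Finset (ZMod 5)) (image σ {y ∈ T | cl y = cl x})
      rw [univ_inter, card_univ, ZMod.card] at h4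
      omega
    obtain ⟨p, hp, q, hq, hpq, he⟩ := exists_ne_map_eq_of_card_lt_of_maps_to
      (s := {b | coverNumber φ cl σ T b = 0}) (t := univ \ image σ {y ∈ T | cl y = cl x})
      (f := φ (cl x)) (by omega) (by
        intro b hb
        simp only [mem_coe, mem_filter, mem_univ, true_and, coverNumber, card_eq_zero,
          filter_eq_empty_iff, mem_sdiff, mem_image, not_exists, not_and] at hb ⊢
        rintro y ⟨hy, hyx⟩ hyb
        exact hb hy (by rw [hyx, hyb]))
    refine ⟨{p, q}, ?_, p, by simp, q, by simp, hpq, he⟩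
    rw [mem_powersetCard]
    refine ⟨?_, card_pair hpq⟩
    intro b hb
    rw [mem_insert, mem_singleton] at hb
    rcases hb with rfl | rfl <;> assumption
  choose! f hf hf' using hpair
  -- Four parallel classes but only three pairs of uncovered points: one pair would be joined by
  -- lines of two different classes.
  obtain ⟨i, hi, j, hj, hij, he⟩ := exists_ne_map_eq_of_card_lt_of_maps_to
    (s := T.image cl) (t := powersetCard 2 {b | coverNumber φ cl σ T b = 0}) (f := f)
    (by rw [card_powersetCard, hZ, hJ]; decide) hf
  have hD : ∀ i ∈ T.image cl, i ∈ D := by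
    intro i hi
    obtain ⟨x, hx, rfl⟩ := mem_image.1 hi
    exact hT x hx
  obtain ⟨p, hp, q, hq, hpq, h1⟩ := hf' i hi
  obtain ⟨p', hp', q', hq', hpq', h2⟩ := hf' j hj
  have hP := (mem_powersetCard.1 (hf j hj)).2
  rw [he] at hp hq
  have hPe : ({p', q'} : Finset B) = f j := by
    refine eq_of_subset_of_card_le ?_ (by rw [hP, card_pair hpq'])
    intro b hb
    rw [mem_insert, mem_singleton] at hb
    rcases hb with rfl | rfl <;> assumption
  rw [← hPe, mem_insert, mem_singleton] at hp hq
  have h3 : φ j p = φ j q := by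
    rcases hp with rfl | rfl <;> rcases hq with rfl | rfl <;> simp_all
  exact hpq (h.eq_of_eq (hD i hi) (hD j hj) hij h1 h3)

theorem card_le_add_eight (h : IsFiveNet D φ) (hT : ∀ x ∈ T, cl x ∈ D)
    (hm : ∀ b, coverNumber φ cl σ T b ≤ 3) {u : ℕ} (hu : u = 3 ∨ u = 4)
    (ha : ∀ i ∈ D, #{y ∈ T | cl y = i} ≤ u) {j : I} (hj : #{y ∈ T | cl y = j} = u) :
    #T ≤ u + 8 := by
  by_cases hinj : ∃ x ∈ T, ∃ y ∈ T, cl x = cl y ∧ σ x = σ y ∧ x ≠ y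
  · obtain ⟨x, hx, y, hy, hxy, hσ, hne⟩ := hinj
    have h1 := h.five_mul_add_le hT hm (hT x hx) (σ x)
    have h2 : 1 < #{z ∈ T | cl z = cl x ∧ σ z = σ x} :=
      one_lt_card.2 ⟨x, by simp [hx], y, by simp [hy, hxy, hσ], hne⟩
    have h3 := card_filter_add_card_filter_not (s := T) (fun z => cl z = cl x)
    have h4 := ha _ (hT x hx)
    simp only [ne_eq] at h1
    omega
  by_contra! hlt
  -- Keeping the whole class `j` retains a class of size exactly `u`; with `u + 9` lines, every
  -- class that occurs has size `u - 1` or `u`.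
  obtain ⟨U, hjU, hUT, hU⟩ := exists_subsuperset_card_eq
    (filter_subset (fun y => cl y = j) T) (by omega : _ ≤ u + 9) (by omega : u + 9 ≤ #T)
  have hT' : ∀ x ∈ U, cl x ∈ D := fun x hx => hT x (hUT hx)
  have hm' : ∀ b, coverNumber φ cl σ U b ≤ 3 := fun b => (coverNumber_mono _ _ _ hUT b).trans (hm b)
  have hinj' : ∀ x ∈ U, ∀ y ∈ U, cl x = cl y → σ x = σ y → x = y := by
    intro x hx y hy h1 h2
    by_contra h3
    exact hinj ⟨x, hUT hx, y, hUT hy, h1, h2, h3⟩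
  have ha' : ∀ x ∈ U, #{y ∈ U | cl y = cl x} ≤ u := fun x hx =>
    (card_le_card (filter_subset_filter _ hUT)).trans (ha _ (hT' x hx))
  have hlow : ∀ x ∈ U, #{y ∈ U | cl y = cl x} = u - 1 ∨ #{y ∈ U | cl y = cl x} = u := by
    intro x hx
    have h1 := h.card_le_card_fiber_add_ten hT' hm' hinj' hx
    have h2 := ha' x hx
    omega
  have hju : #{y ∈ U | cl y = j} = u := by
    rw [← hj]
    congr 1
    ext y
    simp only [mem_filter]
    exact ⟨fun hy => ⟨hUT hy.1, hy.2⟩, fun hy => ⟨hjU (mem_filter.2 hy), hy.2⟩⟩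
  have hge : u ≤ #{x ∈ U | #{y ∈ U | cl y = cl x} = u} := by
    conv_lhs => rw [← hju]
    refine card_le_card fun x hx => ?_
    rw [mem_filter] at hx ⊢
    exact ⟨hx.1, by rw [hx.2, hju]⟩
  have hsplit := card_filter_add_card_filter_not (s := U) (fun x => #{y ∈ U | cl y = cl x} = u)
  have hnot : {x ∈ U | ¬ #{y ∈ U | cl y = cl x} = u} = {x ∈ U | #{y ∈ U | cl y = cl x} = u - 1} :=
    filter_congr fun x hx => by have := hlow x hx; omega
  have hd1 := dvd_card_filter_card_fiber_eq U cl u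
  have hd2 := dvd_card_filter_card_fiber_eq U cl (u - 1)
  rw [hnot] at hsplit
  have hsum : ∑ x ∈ U, #{y ∈ U | cl y = cl x}
      = (u - 1) * #U + #{x ∈ U | #{y ∈ U | cl y = cl x} = u} := by
    rw [card_filter, mul_comm, ← smul_eq_mul, ← sum_const, ← sum_add_distrib]
    refine sum_congr rfl fun x hx => ?_
    have h1 := hlow x hx
    split_ifs <;> omega
  by_cases hex : ∃ x ∈ U, #{y ∈ U | cl y = cl x} = u - 1
  · obtain ⟨x, hx, hx1⟩ := hex
    have hc : #U = 10 + (u - 1) := by omega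
    have ha'' : ∀ x ∈ U, #{y ∈ U | cl y = cl x} ≤ (u - 1) + 1 := fun x hx => by
      have := ha' x hx
      omega
    have h1 := h.ten_le_card_two_add hT' hm' hinj' hc ha'' (hT' x hx) hx1
    have h2 := h.two_mul_card_two hT' hm' hinj' hc ha''
    have h3 : u - 1 ≤ #{x ∈ U | #{y ∈ U | cl y = cl x} = u - 1} := by
      conv_lhs => rw [← hx1]
      refine card_le_card fun y hy => ?_
      rw [mem_filter] at hy ⊢
      exact ⟨hy.1, by rw [hy.2, hx1]⟩
    -- Divisibility forces 6 of the 12 lines (`u = 3`) or 4 of the 13 (`u = 4`) to lie in classes of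
    -- size `u`. Half of that number, 3 or 2, is the number of doubly covered points, while 6 or 4
    -- are required.
    rcases hu with rfl | rfl
    · simp only [Nat.reduceSub] at *
      omega
    · simp only [Nat.reduceSub] at *
      omega
  · have hall : ∀ x ∈ U, #{y ∈ U | cl y = cl x} = u := fun x hx =>
      (hlow x hx).resolve_left fun h1 => hex ⟨x, hx, h1⟩
    rw [filter_true_of_mem hall] at hd1
    rcases hu with rfl | rfl
    · exact h.false_of_card_eq_twelve hT' hm' hinj' (by omega) hall
    · omega

end IsFiveNet

/-! ### The projective plane over the field with 5 elements -/

/-- Normalized homogeneous coordinates of the points, and dually of the lines, of `PG(2, 5)`. -/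
abbrev PG25 : Type := (ZMod 5 × ZMod 5) ⊕ ZMod 5 ⊕ Unit

/-- The representative whose first nonzero coordinate is `1`. -/
def PG25.vec : PG25 → Fin 3 → ZMod 5
  | .inl (x, y) => ![1, x, y]
  | .inr (.inl x) => ![0, 1, x]
  | .inr (.inr _) => ![0, 0, 1]

/-- The standard bilinear form on `R³`. -/
def dot3 {R : Type*} [CommRing R] (v w : Fin 3 → R) : R := v 0 * w 0 + v 1 * w 1 + v 2 * w 2

/-- Incidence in `PG(2, 5)`. -/
abbrev PG25.inc (c d : PG25) : Prop := dot3 c.vec d.vec = 0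

namespace PG25

theorem inc_comm {c d : PG25} : inc c d ↔ inc d c := by
  simp only [inc, dot3, mul_comm]

theorem card_eq : Fintype.card PG25 = 31 := by decide

set_option maxRecDepth 100000 in
theorem card_inc : ∀ c : PG25, #{d : PG25 | inc c d} = 6 := by decide +kernel

theorem card_inc' (d : PG25) : #{c : PG25 | inc c d} = 6 := by
  rw [← card_inc d]
  congr 1
  ext c
  simp [inc_comm]

theorem exists_eq_smul_vec {w : Fin 3 → ZMod 5} (hw : w ≠ 0) :
    ∃ m : ZMod 5, m ≠ 0 ∧ ∃ c : PG25, w = m • c.vec := by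
  have : Fact (Nat.Prime 5) := ⟨by norm_num⟩
  by_cases h0 : w 0 = 0
  · by_cases h1 : w 1 = 0
    · refine ⟨w 2, fun h2 => hw ?_, .inr (.inr ()), ?_⟩
      · ext i
        fin_cases i <;> simp [h0, h1, h2]
      · ext i
        fin_cases i <;> simp [h0, h1, vec]
    · refine ⟨w 1, h1, .inr (.inl ((w 1)⁻¹ * w 2)), ?_⟩
      ext i
      fin_cases i <;> simp [h0, h1, vec]
  · refine ⟨w 0, h0, .inl ((w 0)⁻¹ * w 1, (w 0)⁻¹ * w 2), ?_⟩
    ext i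
    fin_cases i <;> simp [h0, vec]

theorem eq_of_cross_eq_zero {c c' : PG25} (h : crossProduct c.vec c'.vec = 0) : c = c' := by
  have : Fact (Nat.Prime 5) := ⟨by norm_num⟩
  have h0 := congrFun h 0
  have h1 := congrFun h 1
  have h2 := congrFun h 2
  rcases c with ⟨x, y⟩ | x | _ <;> rcases c' with ⟨x', y'⟩ | x' | _ <;>
    simp_all [cross_apply, vec, sub_eq_zero]

theorem dot3_eq_dotProduct {R : Type*} [CommRing R] (v w : Fin 3 → R) : dot3 v w = v ⬝ᵥ w := by
  simp [dot3, dotProduct, Fin.sum_univ_three]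

theorem dot3_smul {R : Type*} [CommRing R] (v w : Fin 3 → R) (r : R) :
    dot3 v (r • w) = r * dot3 v w := by
  simp only [dot3, Pi.smul_apply, smul_eq_mul]
  ring

theorem smul_dot3 {R : Type*} [CommRing R] (v w : Fin 3 → R) (r : R) :
    dot3 (r • v) w = r * dot3 v w := by
  simp only [dot3, Pi.smul_apply, smul_eq_mul]
  ring

theorem exists_line (c c' : PG25) (h : c ≠ c') :
    ∃ d, (inc c d ∧ inc c' d) ∧ ∀ d', inc c d' ∧ inc c' d' → d' = d := by
  have : Fact (Nat.Prime 5) := ⟨by norm_num⟩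
  have hne : crossProduct c.vec c'.vec ≠ 0 := fun h0 => h (eq_of_cross_eq_zero h0)
  obtain ⟨m, hm, d, hd⟩ := exists_eq_smul_vec hne
  have h1 : inc c d := by
    have := dot_self_cross c.vec c'.vec
    rw [hd, ← dot3_eq_dotProduct, dot3_smul] at this
    exact (mul_eq_zero.1 this).resolve_left hm
  have h2 : inc c' d := by
    have := dot_cross_self c.vec c'.vec
    rw [hd, ← dot3_eq_dotProduct, dot3_smul] at this
    exact (mul_eq_zero.1 this).resolve_left hm
  refine ⟨d, ⟨h1, h2⟩, fun d' hd' => ?_⟩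
  simp only [inc, dot3_eq_dotProduct] at h1 h2 hd'
  exact eq_of_cross_eq_zero ((Configuration.ofField.crossProduct_eq_zero_of_dotProduct_eq_zero
    hd'.1 hd'.2 h1 h2).resolve_left hne)

theorem vec_ne_zero : ∀ c : PG25, c.vec ≠ 0 := by decide +kernel

theorem card_inc_inc {c c' : PG25} (h : c ≠ c') : #{d | inc c d ∧ inc c' d} = 1 := by
  obtain ⟨d, hd, hu⟩ := exists_line c c' h
  rw [card_eq_one]
  refine ⟨d, ?_⟩
  ext d'
  simp only [mem_filter, mem_univ, true_and, mem_singleton]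
  exact ⟨hu d', by rintro rfl; exact hd⟩

/-- The point `c` lies on all six lines through it, every other point on just one of them. -/
theorem sum_sum_inc (w : PG25 → ℕ) (c : PG25) :
    ∑ d with inc c d, ∑ c' with inc c' d, w c' = ∑ c', w c' + 5 * w c := by
  have h1 : ∀ d, ∑ c' with inc c' d, w c' = ∑ c', if inc c' d then w c' else 0 :=
    fun d => sum_filter _ _
  simp only [h1]
  rw [sum_comm]
  have h2 : ∀ c', (∑ d with inc c d, if inc c' d then w c' else 0)
      = w c' + if c' = c then 5 * w c' else 0 := by
    intro c'
    rw [← sum_filter, sum_const, filter_filter, smul_eq_mul]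
    by_cases h : c' = c
    · subst h
      simp only [and_self, card_inc, if_true]
      omega
    · rw [card_inc_inc (Ne.symm h), if_neg h]
      omega
  simp only [h2, sum_add_distrib, sum_ite_eq', mem_univ, if_true]

end PG25

/-! ### Numerical contradiction for 44 points -/

/-- The coefficients are tuned so that eliminating `f s` against `5 * N + S ≤ 15 + w`, with `S` the
weight of a direction, bounds a fixed combination of `S` and the sum of squares. -/
theorem exists_sq_le_of_sum_aux : ∀ f : Fin 5 → Fin 4,
    (∑ s, (f s : ℕ) = 5 → ∃ s, 5 * ∑ s, (f s : ℕ) ^ 2 ≤ 5 + 20 * (f s : ℕ)) ∧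
    (∑ s, (f s : ℕ) = 4 → ∑ s, (f s : ℕ) ^ 2 ≤ 4 ∨
      ∃ s, 3 * ∑ s, (f s : ℕ) ^ 2 + 16 ≤ 20 * (f s : ℕ)) ∧
    (∑ s, (f s : ℕ) = 3 → ∑ s, (f s : ℕ) ^ 2 ≤ 3 ∨
      ∃ s, 4 * ∑ s, (f s : ℕ) ^ 2 + 9 ≤ 15 * (f s : ℕ)) ∧
    (∑ s, (f s : ℕ) = 2 → ((∃ s, 2 ≤ (f s : ℕ)) ∧ ∑ s, (f s : ℕ) ^ 2 = 4) ∨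
      (¬ (∃ s, 2 ≤ (f s : ℕ)) ∧ ∑ s, (f s : ℕ) ^ 2 = 2)) := by
  decide +kernel

theorem exists_sq_le_of_sum (f : ZMod 5 → ℕ) (hf : ∀ s, f s ≤ 3) :
    (∑ s, f s = 5 → ∃ s, 5 * ∑ s, f s ^ 2 ≤ 5 + 20 * f s) ∧
    (∑ s, f s = 4 → ∑ s, f s ^ 2 ≤ 4 ∨ ∃ s, 3 * ∑ s, f s ^ 2 + 16 ≤ 20 * f s) ∧
    (∑ s, f s = 3 → ∑ s, f s ^ 2 ≤ 3 ∨ ∃ s, 4 * ∑ s, f s ^ 2 + 9 ≤ 15 * f s) ∧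
    (∑ s, f s = 2 → ((∃ s, 2 ≤ f s) ∧ ∑ s, f s ^ 2 = 4) ∨
      (¬ (∃ s, 2 ≤ f s) ∧ ∑ s, f s ^ 2 = 2)) :=
  exists_sq_le_of_sum_aux fun s => ⟨f s, Nat.lt_succ_of_le (hf s)⟩

/-- Numerical constraints on an arc of size `44` in a projective Hjelmslev plane of order `5`: `w c`
is the number of its points in the neighbour class `c`, and `N d c s` the number of those on the
segment `s` of direction `d`. -/
structure ArcNumbers (w : PG25 → ℕ) (N : PG25 → PG25 → ZMod 5 → ℕ) : Prop where
  total : ∑ c, w c = 44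
  sum_segment : ∀ c d, PG25.inc c d → ∑ s, N d c s = w c
  sum_sq : ∀ c, ∑ d with PG25.inc c d, ∑ s, N d c s ^ 2 = w c ^ 2 + 5 * w c
  five_mul_add_le : ∀ c d, PG25.inc c d → ∀ s,
    5 * N d c s + ∑ c' with PG25.inc c' d, w c' ≤ 15 + w c
  add_le_three : ∀ c c' d, PG25.inc c d → PG25.inc c' d → c ≠ c' → ∀ s s', N d c s + N d c' s' ≤ 3
  le_ten : ∀ d, (∀ c, PG25.inc c d → w c ≤ 2) → (∀ c, PG25.inc c d → ∀ s, N d c s ≤ 1) →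
    ∑ c with PG25.inc c d, w c ≤ 10
  le_add_eight : ∀ c d, PG25.inc c d → w c = 3 ∨ w c = 4 →
    (∀ c', PG25.inc c' d → w c' ≤ w c) → ∑ c' with PG25.inc c' d, w c' ≤ w c + 8

namespace ArcNumbers

open PG25

variable {w : PG25 → ℕ} {N : PG25 → PG25 → ZMod 5 → ℕ}

theorem sum_inc_le (h : ArcNumbers w N) {c : PG25} {B : ℕ} (g : PG25 → ℕ)
    (hg : ∀ d, inc c d → ∑ c' with inc c' d, w c' + g d ≤ B) :
    44 + 5 * w c + ∑ d with inc c d, g d ≤ 6 * B := by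
  rw [← h.total, ← sum_sum_inc, ← sum_add_distrib]
  refine (sum_le_sum (g := fun _ => B) fun d hd => hg d (mem_filter.1 hd).2).trans ?_
  rw [sum_const, card_inc, smul_eq_mul]

theorem sum_inc_combination_le (h : ArcNumbers w N) {c : PG25} {α β B : ℕ}
    (hg : ∀ d, inc c d → α * ∑ c' with inc c' d, w c' + β * ∑ s, N d c s ^ 2 ≤ B) :
    α * (44 + 5 * w c) + β * (w c ^ 2 + 5 * w c) ≤ 6 * B := by
  rw [← h.total, ← sum_sum_inc, ← h.sum_sq, mul_sum, mul_sum, ← sum_add_distrib]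
  refine (sum_le_sum (g := fun _ => B) fun d hd => hg d (mem_filter.1 hd).2).trans ?_
  rw [sum_const, card_inc, smul_eq_mul]

theorem le_sum_inc {c d : PG25} (hcd : inc c d) : w c ≤ ∑ c' with inc c' d, w c' :=
  single_le_sum (f := w) (fun _ _ => Nat.zero_le _) (by simpa using hcd)

theorem segment_le_three (h : ArcNumbers w N) {c d : PG25} (hcd : inc c d) (s : ZMod 5) :
    N d c s ≤ 3 := by
  have h1 := h.five_mul_add_le c d hcd s
  have h2 : w c ≤ _ := le_sum_inc hcd
  omega

theorem weight_le_thirteen (h : ArcNumbers w N) (c : PG25) : w c ≤ 13 := by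
  have h1 := h.sum_inc_combination_le (c := c) (α := 0) (β := 1) (B := 3 * w c) (by
    intro d hcd
    rw [zero_mul, zero_add, one_mul, ← h.sum_segment c d hcd, mul_sum]
    refine sum_le_sum fun s _ => ?_
    rw [sq]
    exact Nat.mul_le_mul_right _ (h.segment_le_three hcd s))
  nlinarith

theorem weight_le_five (h : ArcNumbers w N) (c : PG25) : w c ≤ 5 := by
  by_contra! hlt
  have h13 := h.weight_le_thirteen c
  -- More than five points on five segments of a direction force a double one. Summing the resulting
  -- bounds gives `44 + 5 * w ≤ 30 + 6 * w`, that is `w ≥ 14`, which is why the crude bound 13 comes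
  -- first.
  have h1 := h.sum_inc_le (c := c) (B := 5 + w c) (fun _ => 0) (by
    intro d hcd
    have h2 : ∃ s, 2 ≤ N d c s := by
      by_contra! hN
      have h3 := h.sum_segment c d hcd
      have h4 : ∑ s, N d c s ≤ ∑ _s : ZMod 5, 1 :=
        sum_le_sum fun s _ => Nat.le_of_lt_succ (hN s)
      simp at h4
      omega
    obtain ⟨s, hs⟩ := h2
    have := h.five_mul_add_le c d hcd s
    omega)
  simp at h1
  omega

theorem weight_le_four (h : ArcNumbers w N) (c : PG25) : w c ≤ 4 := by
  by_contra! hlt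
  have h5 : w c = 5 := by have := h.weight_le_five c; omega
  -- Summed over the six directions: `4 * 69 + 5 * 50 = 526`, but `6 * 85 = 510`. Weights 4 and 3
  -- fail likewise, by 364 against 360 and 273 against 270.
  have h1 := h.sum_inc_combination_le (c := c) (α := 4) (β := 5) (B := 85) (by
    intro d hcd
    have h2 := h.sum_segment c d hcd
    obtain ⟨s, hs⟩ := (exists_sq_le_of_sum (N d c) (h.segment_le_three hcd)).1 (by omega)
    have := h.five_mul_add_le c d hcd s
    omega)
  rw [h5] at h1
  omega

theorem weight_le_three (h : ArcNumbers w N) (c : PG25) : w c ≤ 3 := by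
  by_contra! hlt
  have h4 : w c = 4 := by have := h.weight_le_four c; omega
  have h1 := h.sum_inc_combination_le (c := c) (α := 4) (β := 3) (B := 60) (by
    intro d hcd
    have h2 := h.sum_segment c d hcd
    rcases (exists_sq_le_of_sum (N d c) (h.segment_le_three hcd)).2.1 (by omega) with h3 | ⟨s, hs⟩
    · have := h.le_add_eight c d hcd (Or.inr h4) (fun c' _ => by rw [h4]; exact h.weight_le_four c')
      omega
    · have := h.five_mul_add_le c d hcd s
      omega)
  rw [h4] at h1
  omega

theorem weight_le_two (h : ArcNumbers w N) (c : PG25) : w c ≤ 2 := by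
  by_contra! hlt
  have h3 : w c = 3 := by have := h.weight_le_three c; omega
  have h1 := h.sum_inc_combination_le (c := c) (α := 3) (β := 4) (B := 45) (by
    intro d hcd
    have h2 := h.sum_segment c d hcd
    rcases (exists_sq_le_of_sum (N d c) (h.segment_le_three hcd)).2.2.1 (by omega) with h4 | ⟨s, hs⟩
    · have := h.le_add_eight c d hcd (Or.inl h3)
        (fun c' _ => by rw [h3]; exact h.weight_le_three c')
      omega
    · have := h.five_mul_add_le c d hcd s
      omega)
  rw [h3] at h1
  omega

/-- The direction `d` contains two arc points of a common segment in the class `c`. -/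
def Special (N : PG25 → PG25 → ZMod 5 → ℕ) (c d : PG25) : Prop := inc c d ∧ ∃ s, 2 ≤ N d c s

theorem weight_eq_two (h : ArcNumbers w N) {c d : PG25} (hs : Special N c d) : w c = 2 := by
  obtain ⟨hcd, s, hs⟩ := hs
  have h1 := h.weight_le_two c
  have h2 := h.sum_segment c d hcd
  have h3 := single_le_sum (f := N d c) (fun _ _ => Nat.zero_le _) (mem_univ s)
  omega

theorem sum_le_seven (h : ArcNumbers w N) {c d : PG25} (hs : Special N c d) :
    ∑ c' with inc c' d, w c' ≤ 7 := by
  have h1 := h.weight_eq_two hs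
  obtain ⟨hcd, s, hs⟩ := hs
  have := h.five_mul_add_le c d hcd s
  omega

theorem special_unique (h : ArcNumbers w N) {c c' d : PG25} (hs : Special N c d)
    (hs' : Special N c' d) : c = c' := by
  obtain ⟨hcd, s, hs⟩ := hs
  obtain ⟨hcd', s', hs'⟩ := hs'
  by_contra hne
  have := h.add_le_three c c' d hcd hcd' hne s s'
  omega

-- The sum of squares over all directions is `14`; a direction contributes 4 if special and 2
-- otherwise, and there are six.
open Classical in
theorem card_special (h : ArcNumbers w N) {c : PG25} (hc : w c = 2) : #{d | Special N c d} = 1 := by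
  have h1 := h.sum_sq c
  have h2 : ∀ d ∈ ({d | inc c d} : Finset PG25),
      ∑ s, N d c s ^ 2 = 2 + 2 * if ∃ s, 2 ≤ N d c s then 1 else 0 := by
    intro d hd
    have hcd := (mem_filter.1 hd).2
    rcases (exists_sq_le_of_sum (N d c) (h.segment_le_three hcd)).2.2.2
      (by rw [h.sum_segment c d hcd, hc]) with h3 | h3
    · rw [if_pos h3.1, h3.2]
    · rw [if_neg h3.1, h3.2]
  rw [sum_congr rfl h2, sum_add_distrib, sum_const, card_inc, ← mul_sum, ← card_filter,
    filter_filter, hc] at h1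
  have h3 : #{d | Special N c d} = #{d | inc c d ∧ ∃ s, 2 ≤ N d c s} := by congr
  rw [smul_eq_mul] at h1
  omega

open Classical in
theorem card_weight_two_le (h : ArcNumbers w N) :
    #{c | w c = 2} ≤ #{d | ∃ c, Special N c d} := by
  have h1 : ∀ c, w c = 2 → ∃ d, Special N c d := fun c hc => by
    obtain ⟨d, hd⟩ := card_pos.1 (by rw [h.card_special hc]; exact one_pos)
    exact ⟨d, (mem_filter.1 hd).2⟩
  choose! f hf using h1
  refine card_le_card_of_injOn f (fun c hc => ?_) (fun c hc c' hc' he => ?_)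
  · simp only [coe_filter, mem_univ, true_and, Set.mem_ofPred_eq] at hc ⊢
    exact ⟨c, hf c hc⟩
  · simp only [coe_filter, mem_univ, true_and, Set.mem_ofPred_eq] at hc hc'
    exact h.special_unique (hf c hc) (he ▸ hf c' hc')

-- Each of the six directions through `c` has weight at most 10, a special one at most 7, and the
-- weights sum to `44 + 5 * w c`.
open Classical in
theorem three_mul_card_special_inc_le (h : ArcNumbers w N) (c : PG25) :
    3 * #{d | (∃ c, Special N c d) ∧ inc c d} + 5 * w c ≤ 16 := by
  have h1 := h.sum_inc_le (c := c) (B := 10) (fun d => if ∃ c, Special N c d then 3 else 0) (by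
    intro d _
    split_ifs with hs
    · obtain ⟨c', hs⟩ := hs
      have := h.sum_le_seven hs
      omega
    · refine h.le_ten d (fun c _ => h.weight_le_two c) fun c' hcd s => ?_
      by_contra! hlt
      exact hs ⟨c', hcd, s, hlt⟩)
  rw [← sum_filter, filter_filter, sum_const, smul_eq_mul] at h1
  simp only [and_comm (b := inc c _)]
  omega

open Classical in
theorem six_mul_card_special (N : PG25 → PG25 → ZMod 5 → ℕ) :
    6 * #{d | ∃ c, Special N c d} = ∑ c, #{d | (∃ c, Special N c d) ∧ inc c d} := by
  simp only [← filter_filter, card_filter _ ({d | ∃ c, Special N c d} : Finset PG25)]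
  rw [sum_comm, sum_congr rfl (fun d _ => (card_filter (fun c => inc c d) univ).symm),
    sum_congr rfl (fun d _ => card_inc' d), sum_const, smul_eq_mul, mul_comm]

theorem not_arcNumbers : ¬ ArcNumbers w N := by
  classical
  intro h
  have hw := h.weight_le_two
  have htot := h.total
  have h6 := six_mul_card_special N
  have hn2 := h.card_weight_two_le
  have hsum : ∀ k, ∑ _c : PG25, k = 31 * k := fun k => by
    rw [sum_const, card_univ, card_eq, smul_eq_mul]
  have e1 : ∑ c, w c + #{c | w c = 0} = 31 * 1 + #{c | w c = 2} := by
    rw [← hsum, card_filter, card_filter, ← sum_add_distrib,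
      ← sum_add_distrib]
    refine sum_congr rfl fun c _ => ?_
    have := hw c
    split_ifs <;> omega
  have e2 : ∑ c, #{d | (∃ c, Special N c d) ∧ inc c d} + 2 * ∑ c, w c ≤ 31 * 5 + #{c | w c = 2} := by
    rw [← hsum, card_filter _ univ, mul_sum,
      ← sum_add_distrib, ← sum_add_distrib]
    refine sum_le_sum fun c _ => ?_
    have := hw c
    have := h.three_mul_card_special_inc_le c
    split_ifs <;> omega
  -- With `n₀`, `n₂` classes of weight 0, 2 and `t` special directions: `n₂ = n₀ + 13`, and `6 * n₂
  -- ≤ 6 * t ≤ 67 + n₂` gives `n₂ ≤ 13`. Hence `n₀ = 0`.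
  have h0 : ∀ c, 1 ≤ w c := by
    intro c
    have h0 : #{c | w c = 0} = 0 := by omega
    rw [card_eq_zero, filter_eq_empty_iff] at h0
    exact Nat.pos_of_ne_zero (h0 (mem_univ c))
  -- With no empty class, a direction special for another class `c'` and passing through `c` would
  -- have weight at least `6 + 2 = 8`.
  have h1 : ∀ c, w c = 2 → #{d | (∃ c, Special N c d) ∧ inc c d} ≤ 1 := by
    intro c hc
    rw [← h.card_special hc]
    refine card_le_card fun d hd => ?_
    simp only [mem_filter, mem_univ, true_and] at hd ⊢
    obtain ⟨⟨c', hs⟩, hcd⟩ := hd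
    suffices c' = c from this ▸ hs
    by_contra hne
    have h7 := h.sum_le_seven hs
    have hc' := h.weight_eq_two hs
    have h8 : ∑ c'' with inc c'' d, (1 + ((if c'' = c then 1 else 0) + if c'' = c' then 1 else 0))
        ≤ ∑ c'' with inc c'' d, w c'' := by
      refine sum_le_sum fun c'' _ => ?_
      have := h0 c''
      split_ifs with h1 h2 h2
      · exact absurd (h2.symm.trans h1) hne
      · subst h1; omega
      · subst h2; omega
      · omega
    rw [sum_add_distrib, sum_add_distrib, sum_const, card_inc', sum_ite_eq', sum_ite_eq',
      if_pos (by simpa using hcd), if_pos (by simpa using hs.1)] at h8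
    simp only [smul_eq_mul] at h8
    omega
  -- The sharpened count gives `6 * t ≤ 155 - 88 = 67`, so `t ≤ 11`, against `t ≥ n₂ ≥ 13`.
  have e3 : ∑ c, #{d | (∃ c, Special N c d) ∧ inc c d} + 2 * ∑ c, w c ≤ 31 * 5 := by
    rw [← hsum, mul_sum, ← sum_add_distrib]
    refine sum_le_sum fun c _ => ?_
    have := hw c
    have := h0 c
    have := h.three_mul_card_special_inc_le c
    have := h1 c
    omega
  omega

end ArcNumbers

/-! ### From point classes and segments to the numerical constraints -/

namespace PG25

/-- The vectors that vanish at the pivot position of `d`: a complement of the span of `d.vec`. -/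
def complement : PG25 → ZMod 5 × ZMod 5 → Fin 3 → ZMod 5
  | .inl _, b => ![0, b.1, b.2]
  | .inr (.inl _), b => ![b.1, 0, b.2]
  | .inr (.inr _), b => ![b.1, b.2, 0]

theorem complement_sub (d : PG25) (b b' : ZMod 5 × ZMod 5) :
    complement d (b - b') = complement d b - complement d b' := by
  rcases d with _ | _ | _ <;> simp [complement]

theorem eq_zero_of_complement_eq_smul {d : PG25} {b : ZMod 5 × ZMod 5} {m : ZMod 5}
    (h : complement d b = m • d.vec) : b = 0 := by
  have h0 := congrFun h 0
  have h1 := congrFun h 1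
  have h2 := congrFun h 2
  obtain ⟨b1, b2⟩ := b
  have hm : m = 0 := by
    rcases d with ⟨x, y⟩ | x | _ <;> simp [complement, vec] at h0 h1 h2
    · exact h0.symm
    · exact h1.symm
    · exact h2.symm
  subst hm
  rcases d with ⟨x, y⟩ | x | _ <;> simp [complement] at h0 h1 h2 <;> simp [*]

theorem eq_smul_of_dot3_eq_zero {c c' d : PG25} (hne : c ≠ c') (hc : inc c d) (hc' : inc c' d)
    {w : Fin 3 → ZMod 5} (h : dot3 w c.vec = 0) (h' : dot3 w c'.vec = 0) :
    ∃ m : ZMod 5, w = m • d.vec := by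
  have : Fact (Nat.Prime 5) := ⟨by norm_num⟩
  by_cases hw : w = 0
  · exact ⟨0, by simp [hw]⟩
  obtain ⟨m, hm, d', rfl⟩ := exists_eq_smul_vec hw
  rw [smul_dot3] at h h'
  obtain ⟨d₀, -, hu⟩ := exists_line c c' hne
  refine ⟨m, ?_⟩
  rw [hu d' ⟨inc_comm.1 ((mul_eq_zero.1 h).resolve_left hm),
    inc_comm.1 ((mul_eq_zero.1 h').resolve_left hm)⟩, hu d ⟨hc, hc'⟩]

/-- The lines of the line class `d` form an affine plane whose parallel classes are the
neighbour classes of points on `d`. -/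
theorem isFiveNet (d : PG25) :
    IsFiveNet {c | inc c d} fun c b => -dot3 (complement d b) c.vec := by
  have hinter : ∀ c, inc c d → ∀ c', inc c' d → c ≠ c' → ∀ s t,
      #{b | -dot3 (complement d b) c.vec = s ∧ -dot3 (complement d b) c'.vec = t} = 1 := by
    intro c hc c' hc' hne s t
    have hinj : Function.Injective fun b : ZMod 5 × ZMod 5 =>
        (-dot3 (complement d b) c.vec, -dot3 (complement d b) c'.vec) := by
      intro b b' hb
      simp only [Prod.mk.injEq, neg_inj] at hb
      have h1 : dot3 (complement d (b - b')) c.vec = 0 := by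
        rw [complement_sub, dot3_eq_dotProduct, sub_dotProduct, ← dot3_eq_dotProduct,
          ← dot3_eq_dotProduct, hb.1, sub_self]
      have h2 : dot3 (complement d (b - b')) c'.vec = 0 := by
        rw [complement_sub, dot3_eq_dotProduct, sub_dotProduct, ← dot3_eq_dotProduct,
          ← dot3_eq_dotProduct, hb.2, sub_self]
      obtain ⟨m, hm⟩ := eq_smul_of_dot3_eq_zero hne hc hc' h1 h2
      exact sub_eq_zero.1 (eq_zero_of_complement_eq_smul hm)
    obtain ⟨b, hb⟩ := (Finite.injective_iff_surjective.1 hinj) (s, t)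
    rw [card_eq_one]
    refine ⟨b, ?_⟩
    ext b'
    simp only [mem_filter, mem_univ, true_and, mem_singleton]
    rw [← Prod.mk.injEq (-dot3 (complement d b') c.vec) _ s t, ← hb]
    exact hinj.eq_iff
  refine ⟨fun c hc s => ?_, fun c hc c' hc' => hinter c (by simpa using hc) c' (by simpa using hc')⟩
  have hc := (mem_filter.1 hc).2
  obtain ⟨c', hc', hne⟩ := exists_mem_ne (by rw [card_inc']; norm_num : 1 < #{c | inc c d}) c
  rw [mem_filter] at hc'
  rw [card_eq_sum_card_fiberwise (f := fun b => -dot3 (complement d b) c'.vec) (t := univ)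
    (fun _ _ => by simp)]
  simp only [filter_filter]
  rw [sum_congr rfl fun t _ => hinter c hc c' hc'.2 hne.symm s t]
  simp

end PG25

open PG25

section

variable {X : Type*} {A : Finset X} {cl : X → PG25} {σ : PG25 → X → ZMod 5}

theorem card_filter_inc_eq (A : Finset X) (cl : X → PG25) (d : PG25) :
    #{x ∈ A | inc (cl x) d} = ∑ c with inc c d, #{x ∈ A | cl x = c} := by
  rw [card_eq_sum_card_fiberwise (f := cl) (t := {c | inc c d})
    (fun x hx => by simpa using (mem_filter.1 hx).2)]
  refine sum_congr rfl fun c hc => ?_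
  rw [filter_filter]
  congr 1
  ext x
  simp only [mem_filter, mem_univ, true_and] at hc ⊢
  exact ⟨fun hx => ⟨hx.1, hx.2.2⟩, fun hx => ⟨hx.1, hx.2 ▸ hc, hx.2⟩⟩

theorem filter_filter_inc {c d : PG25} (A : Finset X) (cl : X → PG25) (hcd : inc c d) :
    ({x ∈ {x ∈ A | inc (cl x) d} | cl x = c} : Finset X) = {x ∈ A | cl x = c} := by
  ext x
  simp only [mem_filter]
  exact ⟨fun hx => ⟨hx.1.1, hx.2⟩, fun hx => ⟨⟨hx.1, hx.2 ▸ hcd⟩, hx.2⟩⟩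

theorem filter_filter_inc_and {c d : PG25} (A : Finset X) (cl : X → PG25) (τ : X → ZMod 5)
    (hcd : inc c d) (s : ZMod 5) :
    ({x ∈ {x ∈ A | inc (cl x) d} | cl x = c ∧ τ x = s} : Finset X)
      = {x ∈ A | cl x = c ∧ τ x = s} := by
  rw [← filter_filter, filter_filter_inc A cl hcd, filter_filter]

/-- The squares count ordered pairs on a common segment: distinct points share one in exactly one
direction, a point shares one with itself in all six. -/
theorem sum_card_segment_sq (h2 : ∀ x ∈ A, ∀ y ∈ A, x ≠ y → cl x = cl y →
      #{d | inc (cl x) d ∧ σ d x = σ d y} = 1) (c : PG25) :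
    ∑ d with inc c d, ∑ s, #{x ∈ A | cl x = c ∧ σ d x = s} ^ 2
      = #{x ∈ A | cl x = c} ^ 2 + 5 * #{x ∈ A | cl x = c} := by
  classical
  have h3 : ∀ d, ∑ s, #{x ∈ A | cl x = c ∧ σ d x = s} ^ 2
      = ∑ x ∈ A with cl x = c, ∑ y ∈ A with cl y = c, if σ d x = σ d y then 1 else 0 := by
    intro d
    have : ∀ s, #{x ∈ A | cl x = c ∧ σ d x = s} ^ 2
        = ∑ x ∈ A with cl x = c, if σ d x = s then #{y ∈ A | cl y = c ∧ σ d y = s} else 0 := by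
      intro s
      rw [← sum_filter, sum_const, filter_filter, sq, smul_eq_mul]
    simp only [this]
    rw [sum_comm]
    refine sum_congr rfl fun x _ => ?_
    rw [sum_ite_eq, if_pos (mem_univ _), ← card_filter, filter_filter]
    simp only [eq_comm (a := σ d x)]
  simp only [h3]
  rw [sum_comm]
  have h4 : ∀ x ∈ ({x ∈ A | cl x = c} : Finset X),
      ∑ d with inc c d, ∑ y ∈ A with cl y = c, (if σ d x = σ d y then 1 else 0)
        = #{x ∈ A | cl x = c} + 5 := by
    intro x hx
    rw [sum_comm]
    have h5 : ∀ y ∈ ({x ∈ A | cl x = c} : Finset X),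
        (∑ d with inc c d, if σ d x = σ d y then 1 else 0) = 1 + if y = x then 5 else 0 := by
      intro y hy
      rw [mem_filter] at hx hy
      rw [← card_filter, filter_filter]
      by_cases hyx : y = x
      · subst hyx
        simp [card_inc]
      · have := h2 x hx.1 y hy.1 (Ne.symm hyx) (hx.2.trans hy.2.symm)
        rw [hx.2] at this
        rw [this, if_neg hyx]
    rw [sum_congr rfl h5, sum_add_distrib, sum_ite_eq', if_pos hx, ← card_eq_sum_ones]
  rw [sum_congr rfl h4, sum_const, smul_eq_mul]
  ring

theorem arcNumbers_of_card (hA : #A = 44)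
    (h1 : ∀ d (b : Fin 3 → ZMod 5), #{x ∈ A | inc (cl x) d ∧ σ d x + dot3 b (cl x).vec = 0} ≤ 3)
    (h2 : ∀ x ∈ A, ∀ y ∈ A, x ≠ y → cl x = cl y →
      #{d | inc (cl x) d ∧ σ d x = σ d y} = 1) :
    ArcNumbers (fun c => #{x ∈ A | cl x = c}) (fun d c s => #{x ∈ A | cl x = c ∧ σ d x = s}) := by
  have hT : ∀ d, ∀ x ∈ ({x ∈ A | inc (cl x) d} : Finset X), cl x ∈ ({c | inc c d} : Finset PG25) :=
    fun d x hx => by simpa using (mem_filter.1 hx).2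
  have hm : ∀ d b, coverNumber (fun c b => -dot3 (complement d b) c.vec) cl (σ d)
      {x ∈ A | inc (cl x) d} b ≤ 3 := by
    intro d b
    refine le_trans (le_of_eq ?_) (h1 d (complement d b))
    rw [coverNumber, filter_filter]
    congr 1
    ext x
    simp only [mem_filter]
    rw [neg_eq_iff_add_eq_zero, add_comm]
  refine ⟨?_, ?_, sum_card_segment_sq h2, ?_, ?_, ?_, ?_⟩
  · rw [← hA, card_eq_sum_card_fiberwise (f := cl) (t := univ) (fun _ _ => by simp)]
  · intro c d _
    rw [card_eq_sum_card_fiberwise (f := σ d) (t := univ) (fun _ _ => by simp)]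
    simp only [filter_filter]
  · intro c d hcd s
    have h3 := (isFiveNet d).five_mul_add_le (hT d) (hm d) (by simpa using hcd : c ∈ _) s
    have h4 := card_filter_add_card_filter_not (s := {x ∈ A | inc (cl x) d}) (fun x => cl x = c)
    rw [filter_filter_inc A cl hcd, card_filter_inc_eq A cl d] at h4
    rw [filter_filter_inc_and A cl (σ d) hcd] at h3
    simp only [ne_eq] at h3
    omega
  · intro c c' d hcd hcd' hne s s'
    have h3 := (isFiveNet d).add_le_three (hm d) (by simpa using hcd : c ∈ _)
      (by simpa using hcd' : c' ∈ _) hne s s'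
    rwa [filter_filter_inc_and A cl (σ d) hcd, filter_filter_inc_and A cl (σ d) hcd'] at h3
  · intro d hw hN
    rw [← card_filter_inc_eq A cl d]
    refine (isFiveNet d).card_le_ten (hT d) (hm d) (fun x hx y hy hxy hσ => ?_) fun c hc => ?_
    · rw [mem_filter] at hx hy
      exact card_le_one.1 (hN (cl x) hx.2 (σ d x)) x (by simp [hx.1]) y
        (by simp [hy.1, hxy, hσ])
    · have hc := (mem_filter.1 hc).2
      rw [filter_filter_inc A cl hc]
      exact hw c hc
  · intro c d hcd hc hw
    rw [← card_filter_inc_eq A cl d]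
    refine (isFiveNet d).card_le_add_eight (hT d) (hm d) hc (fun c' hc' => ?_) (j := c) ?_
    · have hc' := (mem_filter.1 hc').2
      rw [filter_filter_inc A cl hc']
      exact hw c' hc'
    · rw [filter_filter_inc A cl hcd]

theorem card_le_of_segments
    (h1 : ∀ d (b : Fin 3 → ZMod 5), #{x ∈ A | inc (cl x) d ∧ σ d x + dot3 b (cl x).vec = 0} ≤ 3)
    (h2 : ∀ x ∈ A, ∀ y ∈ A, x ≠ y → cl x = cl y →
      #{d | inc (cl x) d ∧ σ d x = σ d y} = 1) : #A ≤ 43 := by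
  by_contra! hlt
  obtain ⟨A', hA', hc⟩ := exists_subset_card_eq (by omega : 44 ≤ #A)
  exact ArcNumbers.not_arcNumbers (arcNumbers_of_card hc
    (fun d b => (card_le_card (filter_subset_filter _ hA')).trans (h1 d b))
    (fun x hx y hy => h2 x (hA' hx) y (hA' hy)))

end

theorem PG25.card_inc_dot3_eq_zero {c : PG25} {w : Fin 3 → ZMod 5}
    (hw : ∀ r : ZMod 5, w ≠ r • c.vec) : #{d | inc c d ∧ dot3 w d.vec = 0} = 1 := by
  have : Fact (Nat.Prime 5) := ⟨by norm_num⟩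
  obtain ⟨m, hm, c', rfl⟩ := exists_eq_smul_vec (w := w) (by simpa using hw 0)
  have hne : c ≠ c' := by
    rintro rfl
    exact hw m rfl
  rw [← card_inc_inc hne]
  congr 1
  ext d
  simp [smul_dot3, hm]

/-! ### Coordinates over a chain ring of length 2 -/

/-- `R` is a chain ring of length `2` with radical `θR` and residue map `ρ` onto the field with
`5` elements. -/
structure IsChainRingFive {R : Type*} [CommRing R] (ρ : R →+* ZMod 5) (θ : R) : Prop where
  surjective : Function.Surjective ρ
  exists_eq_mul : ∀ r, ρ r = 0 → ∃ s, r = θ * s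
  map_generator : ρ θ = 0
  mul_eq_zero_iff : ∀ r, θ * r = 0 ↔ ρ r = 0

namespace IsChainRingFive

variable {R : Type*} [CommRing R] {ρ : R →+* ZMod 5} {θ : R}

theorem map_dot3 (ρ : R →+* ZMod 5) (v w : Fin 3 → R) :
    ρ (dot3 v w) = dot3 (ρ ∘ v) (ρ ∘ w) := by
  simp [dot3]

theorem mul_eq_mul_iff (h : IsChainRingFive ρ θ) (r s : R) : θ * r = θ * s ↔ ρ r = ρ s := by
  rw [← sub_eq_zero, ← mul_sub, h.mul_eq_zero_iff, map_sub, sub_eq_zero]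

theorem isUnit_one_add (h : IsChainRingFive ρ θ) (r : R) : IsUnit (1 + θ * r) := by
  have h1 : θ * θ = 0 := (h.mul_eq_zero_iff θ).2 h.map_generator
  refine IsUnit.of_mul_eq_one (1 - θ * r) ?_
  linear_combination (-r ^ 2) * h1

theorem isUnit_of_map_ne_zero (h : IsChainRingFive ρ θ) {r : R} (hr : ρ r ≠ 0) : IsUnit r := by
  have : Fact (Nat.Prime 5) := ⟨by norm_num⟩
  obtain ⟨s, hs⟩ := h.surjective (ρ r)⁻¹
  obtain ⟨t, ht⟩ := h.exists_eq_mul (r * s - 1) (by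
    rw [map_sub, map_mul, hs, map_one, mul_inv_cancel₀ hr, sub_self])
  refine isUnit_of_mul_isUnit_left (y := s) ?_
  rw [show r * s = 1 + θ * t by rw [← ht]; ring]
  exact h.isUnit_one_add t

theorem nontrivial (ρ : R →+* ZMod 5) : Nontrivial R := by
  have : Fact (Nat.Prime 5) := ⟨by norm_num⟩
  exact ρ.domain_nontrivial

theorem exists_rep [Finite R] (h : IsChainRingFive ρ θ) (x : PHG.Point R) :
    ∃ c : PG25, ∃ v : Fin 3 → R, ρ ∘ v = c.vec ∧ x.1 = R ∙ v := by
  have : Fact (Nat.Prime 5) := ⟨by norm_num⟩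
  have := nontrivial ρ
  obtain ⟨U, hfree, hrank⟩ := x
  have b := Module.finBasisOfFinrankEq R U hrank
  have hspan : U = R ∙ (b 0 : Fin 3 → R) := by
    ext u
    rw [Submodule.mem_span_singleton]
    constructor
    · intro hu
      refine ⟨b.repr ⟨u, hu⟩ 0, ?_⟩
      have := b.sum_repr ⟨u, hu⟩
      rw [Fin.sum_univ_one] at this
      simpa using congrArg Subtype.val this
    · rintro ⟨r, rfl⟩
      exact U.smul_mem r (b 0).2
  -- A basis vector vanishing modulo the radical would be killed by `θ`; freeness then gives `θ =
  -- 0`, contradicting `mul_eq_zero_iff` at `1`.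
  have hne : ρ ∘ (b 0 : Fin 3 → R) ≠ 0 := by
    intro h0
    have h1 : θ • b 0 = 0 := by
      ext i
      exact (h.mul_eq_zero_iff _).2 (congrFun h0 i)
    have h2 : θ = 0 := by
      have := congrArg (fun u => b.repr u 0) h1
      simpa using this
    have h3 := (h.mul_eq_zero_iff 1).1 (by rw [h2, zero_mul])
    rw [map_one] at h3
    exact one_ne_zero h3
  obtain ⟨m, hm, c, hc⟩ := exists_eq_smul_vec hne
  obtain ⟨r, hr⟩ := h.surjective m⁻¹
  refine ⟨c, r • (b 0 : Fin 3 → R), ?_, ?_⟩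
  · ext i
    have := congrFun hc i
    simp only [Function.comp_apply, Pi.smul_apply, smul_eq_mul] at this
    simp only [Function.comp_apply, Pi.smul_apply, smul_eq_mul, map_mul, hr, this]
    rw [inv_mul_cancel_left₀ hm]
  · rw [Submodule.span_singleton_smul_eq
      (h.isUnit_of_map_ne_zero (by rw [hr]; exact inv_ne_zero hm))]
    exact hspan

/-- The solutions of the linear equation with coefficients `a`. -/
def kernel (a : Fin 3 → R) : Submodule R (Fin 3 → R) where
  carrier := {v | dot3 v a = 0}
  add_mem' {v w} hv hw := by
    simp only [Set.mem_ofPred_eq, dot3, Pi.add_apply] at *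
    linear_combination hv + hw
  zero_mem' := by simp [dot3]
  smul_mem' r v hv := by
    simp only [Set.mem_ofPred_eq] at *
    rw [smul_dot3, hv, mul_zero]

theorem dot3_succAbove (v a : Fin 3 → R) (i : Fin 3) :
    dot3 v a = v i * a i + ∑ j, v (i.succAbove j) * a (i.succAbove j) := by
  rw [dot3_eq_dotProduct, dotProduct, Fin.sum_univ_succAbove _ i]

/-- If a coefficient is invertible, then the corresponding coordinate of a solution is determined
by the other two, which are arbitrary. -/
noncomputable def kernelEquiv {a : Fin 3 → R} {i : Fin 3} (hi : IsUnit (a i)) :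
    kernel a ≃ₗ[R] (Fin 2 → R) where
  toFun v j := v.1 (i.succAbove j)
  map_add' _ _ := rfl
  map_smul' _ _ := rfl
  invFun w := ⟨i.insertNth (-(∑ j, w j * a (i.succAbove j)) * ↑hi.unit⁻¹) w, by
    change dot3 _ a = 0
    rw [dot3_succAbove _ _ i]
    simp only [Fin.insertNth_apply_same, Fin.insertNth_apply_succAbove]
    rw [mul_assoc, IsUnit.val_inv_mul, mul_one, neg_add_cancel]⟩
  left_inv v := by
    have hv : dot3 v.1 a = 0 := v.2
    rw [dot3_succAbove _ _ i] at hv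
    ext j
    rcases Fin.eq_self_or_eq_succAbove i j with rfl | ⟨k, rfl⟩
    · simp only [Fin.insertNth_apply_same]
      rw [← eq_neg_of_add_eq_zero_left hv, mul_assoc, IsUnit.mul_val_inv, mul_one]
    · simp
  right_inv w := by
    ext j
    simp

/-- The line with coordinates `a`. -/
noncomputable def line [Nontrivial R] {a : Fin 3 → R} {i : Fin 3} (hi : IsUnit (a i)) :
    PHG.Line R :=
  ⟨kernel a, Module.Free.of_equiv (kernelEquiv hi).symm, by
    rw [(kernelEquiv hi).finrank_eq, Module.finrank_fintype_fun_eq_card, Fintype.card_fin]⟩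

theorem card_le [Finite R] (h : IsChainRingFive ρ θ) {A : Finset (PHG.Point R)}
    (hA : ∀ S : Finset (PHG.Point R), S ⊆ A → ∀ L : PHG.Line R, (∀ x ∈ S, x.1 ≤ L.1) → #S ≤ 3) :
    #A ≤ 43 := by
  have := nontrivial ρ
  choose cl rep hrep hspan using h.exists_rep
  -- `l` is only a set-theoretic section of `ρ`; this suffices because `θ * r` depends only on `ρ
  -- r`.
  choose l hl using h.surjective
  have hl' : ∀ w : Fin 3 → ZMod 5, ρ ∘ l ∘ w = w := fun w => funext fun i => hl (w i)
  -- The coordinate `s` names the segment of direction `d` through `x`; it is a junk value `0` if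
  -- the class of `x` is not on `d`.
  have hσ : ∀ d x, ∃ s, inc (cl x) d → dot3 (rep x) (l ∘ d.vec) = θ * l s := by
    intro d x
    by_cases hd : inc (cl x) d
    · obtain ⟨s, hs⟩ := h.exists_eq_mul (dot3 (rep x) (l ∘ d.vec)) (by
        rw [map_dot3, hrep, hl']
        exact hd)
      refine ⟨ρ s, fun _ => ?_⟩
      rw [hs, h.mul_eq_mul_iff, hl]
    · exact ⟨0, fun hd' => absurd hd' hd⟩
  choose σ hσ using hσ
  refine card_le_of_segments (cl := cl) (σ := σ) (fun d b => ?_) (fun x hx y hy hne hxy => ?_)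
  · have ha : ∀ i, ρ (l (d.vec i) + θ * l (b i)) = d.vec i := fun i => by
      rw [map_add, map_mul, h.map_generator, hl, zero_mul, add_zero]
    obtain ⟨i, hi⟩ := Function.ne_iff.1 (vec_ne_zero d)
    have hu : IsUnit ((fun i => l (d.vec i) + θ * l (b i)) i) :=
      h.isUnit_of_map_ne_zero (by rw [ha]; exact hi)
    refine hA _ (filter_subset _ _) (line (a := fun i => l (d.vec i) + θ * l (b i)) hu) fun x hx => ?_
    obtain ⟨-, hd, hs⟩ := mem_filter.1 hx
    rw [hspan, Submodule.span_singleton_le_iff_mem]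
    change dot3 _ _ = 0
    have h1 : dot3 (rep x) (fun i => l (d.vec i) + θ * l (b i))
        = dot3 (rep x) (l ∘ d.vec) + θ * dot3 (l ∘ b) (rep x) := by
      simp only [dot3, Function.comp_apply]
      ring
    rw [h1, hσ d x hd, ← mul_add, h.mul_eq_zero_iff, map_add, hl, map_dot3, hl', hrep]
    exact hs
  · have hw : ∀ i, ∃ s, rep y i - rep x i = θ * l s := by
      intro i
      obtain ⟨s, hs⟩ := h.exists_eq_mul (rep y i - rep x i) (by
        rw [map_sub, sub_eq_zero]
        exact congrFun ((hrep y).trans (hxy ▸ (hrep x).symm)) i)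
      exact ⟨ρ s, by rw [hs, h.mul_eq_mul_iff, hl]⟩
    choose w hw using hw
    have hdiff : ∀ d, inc (cl x) d → (σ d x = σ d y ↔ dot3 w d.vec = 0) := by
      intro d hd
      have h1 := hσ d x hd
      have h2 := hσ d y (hxy ▸ hd)
      have h3 : dot3 (rep y) (l ∘ d.vec) - dot3 (rep x) (l ∘ d.vec)
          = θ * dot3 (l ∘ w) (l ∘ d.vec) := by
        simp only [dot3, Function.comp_apply]
        linear_combination (l (d.vec 0)) * hw 0 + (l (d.vec 1)) * hw 1 + (l (d.vec 2)) * hw 2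
      rw [h1, h2, ← mul_sub, h.mul_eq_mul_iff, map_sub, hl, hl, map_dot3, hl', hl'] at h3
      rw [← h3, sub_eq_zero, eq_comm]
    -- If `w` were a multiple of the class vector, the two representatives would differ by a unit `1
    -- + θ * l r` and span the same point.
    have hnot : ∀ r : ZMod 5, w ≠ r • (cl x).vec := by
      intro r hr
      have h1 : rep y = (1 + θ * l r) • rep x := by
        ext i
        have h2 : θ * l (w i) = θ * (l r * rep x i) := by
          rw [h.mul_eq_mul_iff, hl, map_mul, hl, hr]
          exact congrArg (r * ·) (congrFun (hrep x) i).symm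
        rw [Pi.smul_apply, smul_eq_mul]
        linear_combination hw i + h2
      refine hne (Subtype.ext ?_)
      rw [hspan x, hspan y, h1, Submodule.span_singleton_smul_eq (h.isUnit_one_add _)]
    rw [← card_inc_dot3_eq_zero hnot]
    congr 1
    ext d
    simp only [mem_filter, mem_univ, true_and]
    exact and_congr_right (hdiff d)

theorem maxArc_le [Finite R] (h : IsChainRingFive ρ θ) : PHG.maxArc R 3 ≤ 43 := by
  classical
  obtain ⟨K, hK, hk, hL⟩ := (PHG.isGreatest_maxArc R 3).1
  have hK' : ∀ x, K x = if K x = 1 then 1 else 0 := fun x => by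
    rcases hK x with h0 | h0 <;> simp [h0]
  have h1 : PHG.maxArc R 3 = #{x | K x = 1} := by
    rw [← hk, PHG.multiplicity, card_filter]
    exact sum_congr (by simp) fun x _ => hK' x
  rw [h1]
  refine h.card_le fun S hS L hSL => le_trans ?_ (hL L)
  rw [PHG.multiplicity, card_eq_sum_ones]
  refine (sum_le_sum (g := K) fun x hx => ?_).trans
    (sum_le_sum_of_subset fun x hx => mem_filter.2 ⟨mem_univ x, hSL x hx⟩)
  have := (mem_filter.1 (hS hx)).2
  omega

end IsChainRingFive

/-! ### The two rings -/

theorem isChainRingFive_zmod :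
    IsChainRingFive (ZMod.castHom (by norm_num : 5 ∣ 25) (ZMod 5)) (5 : ZMod 25) where
  surjective := ZMod.ringHom_surjective _
  exists_eq_mul := by decide
  map_generator := by decide
  mul_eq_zero_iff := by decide

open Polynomial in
/-- Evaluation at `0` on `𝔽₅[X]/(X²)`. -/
noncomputable def PHG.S5.residue : PHG.S5 →+* ZMod 5 :=
  Ideal.Quotient.lift _ (evalRingHom 0) fun p hp => by
    obtain ⟨q, rfl⟩ := Ideal.mem_span_singleton.1 hp
    simp

open Polynomial in
theorem isChainRingFive_S5 :
    IsChainRingFive PHG.S5.residue (Ideal.Quotient.mk _ X : PHG.S5) where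
  surjective r := ⟨Ideal.Quotient.mk _ (C r), by simp [PHG.S5.residue]⟩
  exists_eq_mul r hr := by
    obtain ⟨p, rfl⟩ := Ideal.Quotient.mk_surjective r
    obtain ⟨q, rfl⟩ : X ∣ p := by
      rw [X_dvd_iff, coeff_zero_eq_eval_zero]
      simpa [PHG.S5.residue] using hr
    exact ⟨Ideal.Quotient.mk _ q, map_mul _ _ _⟩
  map_generator := by simp [PHG.S5.residue]
  mul_eq_zero_iff r := by
    have : Fact (Nat.Prime 5) := ⟨by norm_num⟩
    obtain ⟨p, rfl⟩ := Ideal.Quotient.mk_surjective r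
    rw [← map_mul, Ideal.Quotient.eq_zero_iff_mem, Ideal.mem_span_singleton]
    have h : (X : (ZMod 5)[X]) ^ 2 ∣ X * p ↔ p.eval 0 = 0 := by
      rw [sq, mul_dvd_mul_iff_left X_ne_zero, X_dvd_iff, coeff_zero_eq_eval_zero]
    simp [h, PHG.S5.residue]

theorem mainTheorem12 :
    PHG.maxArc (ZMod 25) 3 ≤ 43 ∧ PHG.maxArc PHG.S5 3 ≤ 43 := by
  exact ⟨isChainRingFive_zmod.maxArc_le, isChainRingFive_S5.maxArc_le⟩
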